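/- Work in the category $\mathbf{Loc}$ of locales, the opposite of the category of frames; for a morphism $f : X \to Y$ write $f^* : \mathcal{O}Y \to \mathcal{O}X$ for its frame homomorphism. The morphism $f$ is open if $f^*$ has a left adjoint $f_!$ with $f_!(f^*(u)\wedge v) = u \wedge f_!(v)$; it is an open surjection if it is open and an epimorphism; it is a local homeomorphism if both $f$ and its diagonal $X \to X\times_Y X$ are open. For a local homeomorphism $r : Y \to U$ with diagonal $\Delta : Y \to Y\times_U Y$ and projections $\pi_1,\pi_2 : Y\times_U Y \to Y$, a partial surjection over $U$ from $\mathbb{N}$ onto $Y$ is a family of opens $[f(n)=y] = F_n \in \mathcal{O}Y$, $n\in\mathbb{N}$ (that is, an open of $\mathbb{N}\times Y$, the graph), such that \[ \pi_1^*(F_n)\wedge \pi_2^*(F_n) \le \Delta_!(\top) \ \text{ for all } n\in\mathbb{N} \quad\text{(functionality)}, \qquad \bigvee_{n\in\mathbb{N}} F_n = \top \quad\text{(surjectivity)}. \] Let $p : X \to H$ be a local homeomorphism of locales. Then there are a locale $[\mathbb{N}\rightharpoondown_H X]$ and an open surjection $q : [\mathbb{N}\rightharpoondown_H X] \to H$ such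 that, for every locale $U$, the generalised points $t : U \to [\mathbb{N}\rightharpoondown_H X]$ are in bijection with the pairs consisting of a generalised point $h : U \to H$ and a partial surjection over $U$ from $\mathbb{N}$ onto the fibre $p^{-1}(h)$, the pullback $U\times_H X \to U$ of $p$ along $h$. The bijection is natural in $U$ (precomposition with $g : V \to U$ corresponds to pulling $h$ and the graph back along $g$), and the first component of the pair corresponding to $t$ is $h = q\circ t$. -/

import Mathlib

open CategoryTheory CategoryTheory.Limits

universe u

namespace Locale

/-- The frame homomorphism `f^* : O Y → O X` of a locale morphism `f : X ⟶ Y`. -/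
def inv {X Y : Locale.{u}} (f : X ⟶ Y) : FrameHom Y X :=
  Frm.Hom.hom (Quiver.Hom.unop f)

/-- The locale morphism with a given inverse image frame homomorphism. -/
def ofInv {X Y : Locale.{u}} (φ : FrameHom Y X) : X ⟶ Y :=
  Quiver.Hom.op (Frm.ofHom φ)

@[simp] theorem inv_ofInv {X Y : Locale.{u}} (φ : FrameHom Y X) : inv (ofInv φ) = φ := rfl

@[simp] theorem ofInv_inv {X Y : Locale.{u}} (f : X ⟶ Y) : ofInv (inv f) = f := rfl

@[simp] theorem inv_comp {X Y Z : Locale.{u}} (f : X ⟶ Y) (g : Y ⟶ Z) :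
    inv (f ≫ g) = (inv f).comp (inv g) := rfl

@[simp] theorem inv_id (X : Locale.{u}) : inv (𝟙 X) = FrameHom.id X := rfl

theorem hom_ext {X Y : Locale.{u}} {f g : X ⟶ Y} (h : ∀ v, inv f v = inv g v) : f = g := by
  rw [← ofInv_inv f, ← ofInv_inv g]
  exact congrArg ofInv (FrameHom.ext h)

/-! ### Pullbacks of locales

The frame of a pullback is the pushout of frames `B ⊗_A C`, realised as the frame of those lower
sets of `B × C` that are closed under joins in each variable and balanced over `A`. -/

section Pushout

variable {A B C : Type u} [Order.Frame A] [Order.Frame B] [Order.Frame C]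

theorem mem_himp_lowerSet (E D : LowerSet (B × C)) (x : B × C) :
    x ∈ E ⇨ D ↔ ∀ y ≤ x, y ∈ E → y ∈ D := by
  rw [← LowerSet.Iic_le, le_himp_iff]
  constructor
  · intro h y hy hE
    exact h (show y ∈ LowerSet.Iic x ⊓ E from ⟨hy, hE⟩)
  · rintro h y ⟨hy, hE⟩
    exact h y hy hE

/-- The pushout of frames `B ⊗_A C`. -/
def pushoutFrame (f : FrameHom A B) (g : FrameHom A C) : Sublocale (LowerSet (B × C)) where
  carrier := {D |
    (∀ (S : Set B) (c : C), (∀ b ∈ S, (b, c) ∈ D) → (sSup S, c) ∈ D) ∧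
    (∀ (b : B) (S : Set C), (∀ c ∈ S, (b, c) ∈ D) → (b, sSup S) ∈ D) ∧
    (∀ (a : A) (b : B) (c : C), (b ⊓ f a, c) ∈ D ↔ (b, c ⊓ g a) ∈ D)}
  sInf_mem' := by
    intro s hs
    refine ⟨fun S c h => ?_, fun b S h => ?_, fun a b c => ?_⟩
    · rw [LowerSet.mem_sInf_iff]
      intro D hD
      exact (hs hD).1 S c fun b hb => LowerSet.mem_sInf_iff.1 (h b hb) D hD
    · rw [LowerSet.mem_sInf_iff]
      intro D hD
      exact (hs hD).2.1 b S fun c hc => LowerSet.mem_sInf_iff.1 (h c hc) D hD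
    · rw [LowerSet.mem_sInf_iff, LowerSet.mem_sInf_iff]
      exact forall₂_congr fun D hD => (hs hD).2.2 a b c
  himp_mem' := by
    rintro E D ⟨h₁, h₂, h₃⟩
    refine ⟨fun S c h => ?_, fun b S h => ?_, fun a b c => ?_⟩
    · rw [mem_himp_lowerSet]
      rintro ⟨b', c'⟩ ⟨hb, hc⟩ hE
      have key := h₁ ((fun s => b' ⊓ s) '' S) c' (by
        rintro _ ⟨s, hs, rfl⟩
        exact (mem_himp_lowerSet E D _).1 (h s hs) _ ⟨inf_le_right, hc⟩
          (E.lower (show ((b' ⊓ s, c') : B × C) ≤ (b', c') from ⟨inf_le_left, le_rfl⟩) hE))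
      rw [sSup_image, ← inf_sSup_eq] at key
      rwa [inf_eq_left.2 hb] at key
    · rw [mem_himp_lowerSet]
      rintro ⟨b', c'⟩ ⟨hb, hc⟩ hE
      have key := h₂ b' ((fun s => c' ⊓ s) '' S) (by
        rintro _ ⟨s, hs, rfl⟩
        exact (mem_himp_lowerSet E D _).1 (h s hs) _ ⟨hb, inf_le_right⟩
          (E.lower (show ((b', c' ⊓ s) : B × C) ≤ (b', c') from ⟨le_rfl, inf_le_left⟩) hE))
      rw [sSup_image, ← inf_sSup_eq] at key
      rwa [inf_eq_left.2 hc] at key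
    · rw [mem_himp_lowerSet, mem_himp_lowerSet]
      constructor
      · rintro h ⟨b', c'⟩ ⟨hb, hc⟩ hE
        have hc' : c' ≤ c ⊓ g a := hc
        have := (h₃ a b' c').1 (h (b' ⊓ f a, c')
          ⟨inf_le_inf_right _ hb, hc'.trans inf_le_left⟩
          (E.lower (show ((b' ⊓ f a, c') : B × C) ≤ (b', c') from ⟨inf_le_left, le_rfl⟩) hE))
        rwa [inf_eq_left.2 (hc'.trans inf_le_right)] at this
      · rintro h ⟨b', c'⟩ ⟨hb, hc⟩ hE
        have hb' : b' ≤ b ⊓ f a := hb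
        have := (h₃ a b' c').2 (h (b', c' ⊓ g a)
          ⟨hb'.trans inf_le_left, inf_le_inf_right _ hc⟩
          (E.lower (show ((b', c' ⊓ g a) : B × C) ≤ (b', c') from ⟨le_rfl, inf_le_left⟩) hE))
        rwa [inf_eq_left.2 (hb'.trans inf_le_right)] at this

variable (f : FrameHom A B) (g : FrameHom A C)

/-- The pure tensor `b ⊗ c`. -/
def pushoutTmul (b : B) (c : C) : pushoutFrame f g :=
  (pushoutFrame f g).restrict (LowerSet.Iic (b, c))

theorem pushoutTmul_le_iff (b : B) (c : C) (D : pushoutFrame f g) :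
    pushoutTmul f g b c ≤ D ↔ (b, c) ∈ (D : LowerSet (B × C)) := by
  rw [pushoutTmul, (pushoutFrame f g).giRestrict.gc _ _, LowerSet.Iic_le]

theorem pushoutTmul_inf (b b' : B) (c c' : C) :
    pushoutTmul f g b c ⊓ pushoutTmul f g b' c' = pushoutTmul f g (b ⊓ b') (c ⊓ c') := by
  rw [pushoutTmul, pushoutTmul, ← map_inf, pushoutTmul]
  congr 1
  ext ⟨x, y⟩
  simp

/-- The coprojection `b ↦ b ⊗ ⊤`. -/
def pushoutInl : FrameHom B (pushoutFrame f g) where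
  toFun b := pushoutTmul f g b ⊤
  map_inf' b b' := by rw [pushoutTmul_inf, inf_idem]
  map_top' := top_unique ((pushoutFrame f g).restrict.map_top' ▸
    OrderHomClass.mono (pushoutFrame f g).restrict (by
      intro x _
      exact (le_top : x ≤ (⊤, ⊤))))
  map_sSup' S := by
    apply le_antisymm
    · rw [pushoutTmul_le_iff]
      refine (sSup ((fun b => pushoutTmul f g b ⊤) '' S)).2.1 S ⊤ fun b hb => ?_
      rw [← pushoutTmul_le_iff]
      exact le_sSup ⟨b, hb, rfl⟩
    · refine sSup_le ?_
      rintro _ ⟨b, hb, rfl⟩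
      exact OrderHomClass.mono (pushoutFrame f g).restrict (LowerSet.Iic_le.2 ⟨le_sSup hb, le_rfl⟩)

/-- The coprojection `c ↦ ⊤ ⊗ c`. -/
def pushoutInr : FrameHom C (pushoutFrame f g) where
  toFun c := pushoutTmul f g ⊤ c
  map_inf' c c' := by rw [pushoutTmul_inf, inf_idem]
  map_top' := (pushoutInl f g).map_top'
  map_sSup' S := by
    apply le_antisymm
    · rw [pushoutTmul_le_iff]
      refine (sSup ((fun c => pushoutTmul f g ⊤ c) '' S)).2.2.1 ⊤ S fun c hc => ?_
      rw [← pushoutTmul_le_iff]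
      exact le_sSup ⟨c, hc, rfl⟩
    · refine sSup_le ?_
      rintro _ ⟨c, hc, rfl⟩
      exact OrderHomClass.mono (pushoutFrame f g).restrict (LowerSet.Iic_le.2 ⟨le_rfl, le_sSup hc⟩)

theorem pushoutInl_inf_inr (b : B) (c : C) :
    pushoutInl f g b ⊓ pushoutInr f g c = pushoutTmul f g b c := by
  change pushoutTmul f g b ⊤ ⊓ pushoutTmul f g ⊤ c = _
  rw [pushoutTmul_inf, inf_top_eq, top_inf_eq]

theorem pushout_condition (a : A) : pushoutInl f g (f a) = pushoutInr f g (g a) := by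
  change pushoutTmul f g (f a) ⊤ = pushoutTmul f g ⊤ (g a)
  apply le_antisymm
  · rw [pushoutTmul_le_iff]
    have := ((pushoutTmul f g ⊤ (g a)).2.2.2 a ⊤ ⊤).2
    rw [top_inf_eq, top_inf_eq] at this
    exact this ((pushoutTmul_le_iff f g _ _ _).1 le_rfl)
  · rw [pushoutTmul_le_iff]
    have := ((pushoutTmul f g (f a) ⊤).2.2.2 a ⊤ ⊤).1
    rw [top_inf_eq, top_inf_eq] at this
    exact this ((pushoutTmul_le_iff f g _ _ _).1 le_rfl)

theorem pushout_eq_sSup (D : pushoutFrame f g) :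
    D = sSup ((fun x : B × C => pushoutTmul f g x.1 x.2) '' {x | x ∈ (D : LowerSet (B × C))}) := by
  apply le_antisymm
  · intro x hx
    exact (pushoutTmul_le_iff f g x.1 x.2 _).1 (le_sSup ⟨x, hx, rfl⟩)
  · refine sSup_le ?_
    rintro _ ⟨x, hx, rfl⟩
    exact (pushoutTmul_le_iff f g _ _ _).2 hx

variable {Z : Type u} [Order.Frame Z] (h : FrameHom B Z) (k : FrameHom C Z)

/-- The value of the mediating homomorphism on an element of the pushout. -/
def pushoutDescFun (D : pushoutFrame f g) : Z :=
  sSup ((fun x : B × C => h x.1 ⊓ k x.2) '' {x | x ∈ (D : LowerSet (B × C))})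

theorem pushoutDesc_exists_adjoint (w : ∀ a, h (f a) = k (g a)) :
    ∃ r : Z → pushoutFrame f g, GaloisConnection (pushoutDescFun f g h k) r ∧
      ∀ z b c, (b, c) ∈ (r z : LowerSet (B × C)) ↔ h b ⊓ k c ≤ z := by
  refine ⟨fun z => ⟨⟨{x | h x.1 ⊓ k x.2 ≤ z}, ?_⟩, ?_, ?_, ?_⟩, ?_, fun z b c => Iff.rfl⟩
  · intro x y hyx hx
    exact (inf_le_inf (OrderHomClass.mono h hyx.1) (OrderHomClass.mono k hyx.2)).trans hx
  · intro S c hS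
    change h (sSup S) ⊓ k c ≤ z
    rw [map_sSup, sSup_inf_eq]
    refine iSup₂_le ?_
    rintro _ ⟨b, hb, rfl⟩
    exact hS b hb
  · intro b S hS
    change h b ⊓ k (sSup S) ≤ z
    rw [map_sSup, inf_sSup_eq]
    refine iSup₂_le ?_
    rintro _ ⟨c, hc, rfl⟩
    exact hS c hc
  · intro a b c
    change h (b ⊓ f a) ⊓ k c ≤ z ↔ h b ⊓ k (c ⊓ g a) ≤ z
    rw [map_inf, map_inf, w, inf_assoc, inf_comm (k (g a))]
  · intro D z
    constructor
    · intro hD x hx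
      have hle : h x.1 ⊓ k x.2 ≤ pushoutDescFun f g h k D := le_sSup ⟨x, hx, rfl⟩
      exact hle.trans hD
    · intro hD
      refine sSup_le ?_
      rintro _ ⟨x, hx, rfl⟩
      exact hD hx

/-- The mediating homomorphism out of the pushout. -/
def pushoutDesc (w : ∀ a, h (f a) = k (g a)) : FrameHom (pushoutFrame f g) Z where
  toFun := pushoutDescFun f g h k
  map_inf' D E := by
    obtain ⟨r, hr, -⟩ := pushoutDesc_exists_adjoint f g h k w
    apply le_antisymm
    · exact hr.monotone_l.map_inf_le D E
    · unfold pushoutDescFun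
      rw [sSup_inf_sSup]
      refine iSup₂_le ?_
      rintro ⟨_, _⟩ ⟨⟨x, hx, rfl⟩, ⟨y, hy, rfl⟩⟩
      have hxy : x ⊓ y ∈ ((D ⊓ E : pushoutFrame f g) : LowerSet (B × C)) :=
        ⟨LowerSet.lower _ (inf_le_left : x ⊓ y ≤ x) hx,
          LowerSet.lower _ (inf_le_right : x ⊓ y ≤ y) hy⟩
      have hval : h x.1 ⊓ k x.2 ⊓ (h y.1 ⊓ k y.2) = h (x.1 ⊓ y.1) ⊓ k (x.2 ⊓ y.2) := by
        rw [map_inf, map_inf, inf_inf_inf_comm]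
      exact hval.le.trans (le_sSup ⟨x ⊓ y, hxy, rfl⟩)
  map_top' := by
    refine top_unique (le_sSup ⟨(⊤, ⊤), ?_, ?_⟩)
    · exact (pushoutTmul_le_iff f g _ _ _).1 le_top
    · change h ⊤ ⊓ k ⊤ = ⊤
      rw [map_top, map_top, inf_top_eq]
  map_sSup' S := by
    obtain ⟨r, hr, -⟩ := pushoutDesc_exists_adjoint f g h k w
    rw [hr.l_sSup, sSup_image]

theorem pushoutDesc_tmul (w : ∀ a, h (f a) = k (g a)) (b : B) (c : C) :
    pushoutDesc f g h k w (pushoutTmul f g b c) = h b ⊓ k c := by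
  obtain ⟨r, hr, hm⟩ := pushoutDesc_exists_adjoint f g h k w
  refine eq_of_forall_ge_iff fun z => ?_
  change pushoutDescFun f g h k _ ≤ z ↔ _
  rw [hr _ _, pushoutTmul_le_iff, hm]

theorem pushoutDesc_inl (w : ∀ a, h (f a) = k (g a)) (b : B) :
    pushoutDesc f g h k w (pushoutInl f g b) = h b := by
  refine (pushoutDesc_tmul f g h k w b ⊤).trans ?_
  rw [map_top, inf_top_eq]

theorem pushoutDesc_inr (w : ∀ a, h (f a) = k (g a)) (c : C) :
    pushoutDesc f g h k w (pushoutInr f g c) = k c := by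
  refine (pushoutDesc_tmul f g h k w ⊤ c).trans ?_
  rw [map_top, top_inf_eq]

theorem pushout_hom_ext {m m' : FrameHom (pushoutFrame f g) Z}
    (h₁ : ∀ b, m (pushoutInl f g b) = m' (pushoutInl f g b))
    (h₂ : ∀ c, m (pushoutInr f g c) = m' (pushoutInr f g c)) : m = m' := by
  refine FrameHom.ext fun D => ?_
  rw [pushout_eq_sSup f g D, map_sSup, map_sSup, Set.image_image, Set.image_image]
  congr 1
  refine Set.image_congr fun x _ => ?_
  rw [← pushoutInl_inf_inr, map_inf, map_inf, h₁, h₂]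

end Pushout

/-- The pullback cone of locales given by the pushout of frames. -/
def pullbackConeOfFrames {X Y Z : Locale.{u}} (f : X ⟶ Z) (g : Y ⟶ Z) : PullbackCone f g :=
  PullbackCone.mk (W := Locale.of (pushoutFrame (inv f) (inv g)))
    (ofInv (X := Locale.of (pushoutFrame (inv f) (inv g))) (pushoutInl (inv f) (inv g)))
    (ofInv (X := Locale.of (pushoutFrame (inv f) (inv g))) (pushoutInr (inv f) (inv g)))
    (hom_ext fun a => pushout_condition (inv f) (inv g) a)

/-- The pullback cone given by the pushout of frames is a pullback. -/
def pullbackConeOfFramesIsLimit {X Y Z : Locale.{u}} (f : X ⟶ Z) (g : Y ⟶ Z) :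
    IsLimit (pullbackConeOfFrames f g) :=
  PullbackCone.IsLimit.mk _
    (fun s => ofInv (Y := Locale.of (pushoutFrame (inv f) (inv g)))
      (pushoutDesc (inv f) (inv g) (inv s.fst) (inv s.snd)
        fun a => congrArg (fun t => inv t a) s.condition))
    (fun s => hom_ext fun b => pushoutDesc_inl (inv f) (inv g) (inv s.fst) (inv s.snd)
      (fun a => congrArg (fun t => inv t a) s.condition) b)
    (fun s => hom_ext fun c => pushoutDesc_inr (inv f) (inv g) (inv s.fst) (inv s.snd)
      (fun a => congrArg (fun t => inv t a) s.condition) c)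
    (fun s m h₁ h₂ => congrArg ofInv (pushout_hom_ext (inv f) (inv g) (m := inv m)
      (fun b => (congrArg (fun t => inv t b) h₁).trans
        (pushoutDesc_inl (inv f) (inv g) (inv s.fst) (inv s.snd)
          (fun a => congrArg (fun t => inv t a) s.condition) b).symm)
      (fun c => (congrArg (fun t => inv t c) h₂).trans
        (pushoutDesc_inr (inv f) (inv g) (inv s.fst) (inv s.snd)
          (fun a => congrArg (fun t => inv t a) s.condition) c).symm)))

instance : HasPullbacks Locale.{u} :=
  haveI : ∀ {X Y Z : Locale.{u}} {f : X ⟶ Z} {g : Y ⟶ Z}, HasLimit (cospan f g) :=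
    fun {_ _ _ f g} => HasLimit.mk ⟨pullbackConeOfFrames f g, pullbackConeOfFramesIsLimit f g⟩
  hasPullbacks_of_hasLimit_cospan _

/-! ### Open maps and local homeomorphisms -/

/-- A locale morphism `f` is open if `f^*` has a left adjoint satisfying Frobenius reciprocity. -/
def IsOpenMap {X Y : Locale.{u}} (f : X ⟶ Y) : Prop :=
  ∃ l : X → Y, GaloisConnection l (inv f) ∧
    ∀ (u : Y) (v : X), l (inv f u ⊓ v) = u ⊓ l v

/-- An open surjection is an open epimorphism of locales. -/
def IsOpenSurjection {X Y : Locale.{u}} (f : X ⟶ Y) : Prop :=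
  IsOpenMap f ∧ Epi f

/-- A local homeomorphism is an open morphism with open diagonal. -/
def IsLocalHomeo {X Y : Locale.{u}} (f : X ⟶ Y) : Prop :=
  IsOpenMap f ∧ IsOpenMap (pullback.diagonal f)

/-- The equality predicate `⟦y = y'⟧` of a locale `Y` over `U`, as an open of `Y ×_U Y`: the least
open containing the diagonal `Δ`.  When `Δ` is open, this is `Δ_! ⊤`, the open sublocale
corresponding to the diagonal. -/
noncomputable def eqPred {Y U : Locale.{u}} (r : Y ⟶ U) : (pullback r r : Locale.{u}) :=
  sInf {d : (pullback r r : Locale.{u}) | inv (pullback.diagonal r) d = ⊤}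

theorem eqPred_eq {Y U : Locale.{u}} (r : Y ⟶ U) (l : Y → (pullback r r : Locale.{u}))
    (hl : GaloisConnection l (inv (pullback.diagonal r))) : eqPred r = l ⊤ := by
  refine le_antisymm (sInf_le (top_unique (hl.le_u_l ⊤))) (le_sInf fun d hd => ?_)
  exact (hl ⊤ d).2 (le_of_eq (Eq.symm hd))

/-! ### Partial surjections onto the fibres -/

/-- A partial surjection over `U` from the constant object `ℕ` onto `r : Y ⟶ U` (internally to
sheaves on `U`), given by its graph.  The graph is an open of `ℕ × Y`, that is, a family of opens
`[f(n) = y]` of `Y` indexed by `n : ℕ`, and it satisfies the two axioms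
`[f(n) = y] ∧ [f(n) = y'] ⊢ ⟦y = y'⟧` and `⊢ ⋁ n, [f(n) = y]`. -/
structure PartialSurjection {Y U : Locale.{u}} (r : Y ⟶ U) where
  graph : ℕ → Y
  functional : ∀ n, inv (pullback.fst r r) (graph n) ⊓ inv (pullback.snd r r) (graph n) ≤ eqPred r
  surjective : ⨆ n, graph n = ⊤

/-- A pair of a generalised point `h : U ⟶ H` of `H` and a partial surjection over `U` from `ℕ`
onto the fibre `p⁻¹(h)`, the pullback of `p` along `h`. -/
structure FibrePartialSurjection {X H : Locale.{u}} (p : X ⟶ H) (U : Locale.{u}) where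
  point : U ⟶ H
  partialSurjection : PartialSurjection (pullback.snd p point)

/-- The comparison `p⁻¹(h') ⟶ p⁻¹(h)` of fibres, over `g : V ⟶ U`, when `h' = g ≫ h`. -/
noncomputable def fibreMap {X H : Locale.{u}} (p : X ⟶ H) {U V : Locale.{u}} (g : V ⟶ U)
    {h : U ⟶ H} {h' : V ⟶ H} (w : h' = g ≫ h) : pullback p h' ⟶ pullback p h :=
  pullback.lift (pullback.fst p h') (pullback.snd p h' ≫ g)
    (by rw [Category.assoc, ← w, pullback.condition])

/-- `b` is the restriction (change of base) of `a` along `g : V ⟶ U`. -/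
def FibrePartialSurjection.IsRestriction {X H : Locale.{u}} {p : X ⟶ H} {U V : Locale.{u}}
    (g : V ⟶ U) (a : FibrePartialSurjection p U) (b : FibrePartialSurjection p V) : Prop :=
  ∃ w : b.point = g ≫ a.point, ∀ n,
    b.partialSurjection.graph n = inv (fibreMap p g w) (a.partialSurjection.graph n)

end Locale

namespace Locale

/-! ### The frame of finite conditions on a partial surjection -/

/-! Let `s` and `r` be the projections of a fibre to `X` and `U`. A graph `F_n` is encoded by the
truth values `φ_n(u) = r_!(F_n ∧ s^*u)` of "f(n) ∈ u", for `u` an open of `X`. These always preserve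
joins and are linear over `O H`; functionality makes them preserve binary meets, and surjectivity
becomes `⋁_n φ_n(u) = h^* p_!(u)`. Nothing is lost: as `p` is a local homeomorphism, `X` is covered
by opens `u` on which `p` is monic, and `F_n` is the join of `s^*u ∧ r^*φ_n(u)` over these `u`
(`graphOfValue_valueOfGraph`, `IsEnumeration.valueOfGraph_graphOfValue`). The tools are
Beck-Chevalley for open maps and `functional_iff`, which rewrites functionality in terms of `r_!`.

The encoded data are models in `O U` of a propositional geometric theory, so they are classified by
a frame with generators and relations. The generators are pairs of an open of `H` and a finite
condition; `IsEnumeration.desc` and `enumerationFrame_hom_ext` give the universal property.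

The projection `q` is open because its direct image has an explicit formula: `(a, σ)` goes to `a ∧
⋀_n p_!(σ n)`. The point to check is the surjectivity relation: a finite condition leaves some `n`
free, and requiring "f(n) ∈ b" there costs exactly `p_!(b)`
(`conditionValue_directImage_exists_adjoint`). The same formula shows that `q^*` is injective, so
`q` is an epimorphism. -/

/-- A finite condition on a partial function from `ℕ` to a locale with frame `B`: finitely many
requirements `f(n) ∈ σ n`, where `⊤` stands for no requirement. -/
abbrev FiniteCondition (B : Type u) [Order.Frame B] : Type u :=
  {σ : ℕ → WithTop B // {n | σ n ≠ ⊤}.Finite}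

namespace FiniteCondition

variable {B : Type u} [Order.Frame B]

instance : SemilatticeInf (FiniteCondition B) :=
  Subtype.semilatticeInf fun σ τ hσ hτ => (hσ.union hτ).subset fun n hn => by
    by_contra h
    simp only [Set.mem_union, Set.mem_ofPred_eq, not_or, not_not] at h
    exact hn (by rw [Pi.inf_apply, h.1, h.2, inf_idem])

instance : OrderTop (FiniteCondition B) where
  top := ⟨fun _ => ⊤, by simp⟩
  le_top _ _ := le_top

@[simp] theorem inf_apply (σ τ : FiniteCondition B) (n : ℕ) : (σ ⊓ τ).1 n = σ.1 n ⊓ τ.1 n := rfl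

@[simp] theorem top_apply (n : ℕ) : (⊤ : FiniteCondition B).1 n = ⊤ := rfl

/-- Replace the requirement at `n`. -/
def update (σ : FiniteCondition B) (n : ℕ) (x : WithTop B) : FiniteCondition B :=
  ⟨Function.update σ.1 n x, (σ.2.union (Set.finite_singleton n)).subset fun m hm => by
    by_cases h : m = n
    · exact Or.inr h
    · refine Or.inl ?_
      rwa [Set.mem_ofPred_eq, Function.update_of_ne h] at hm⟩

@[simp] theorem update_self (σ : FiniteCondition B) (n : ℕ) (x : WithTop B) :
    (σ.update n x).1 n = x := Function.update_self ..

theorem update_of_ne (σ : FiniteCondition B) {n m : ℕ} (h : m ≠ n) (x : WithTop B) :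
    (σ.update n x).1 m = σ.1 m := Function.update_of_ne h ..

@[simp] theorem update_eq_self (σ : FiniteCondition B) (n : ℕ) : σ.update n (σ.1 n) = σ :=
  Subtype.ext (Function.update_eq_self ..)

theorem update_mono {σ τ : FiniteCondition B} (h : σ ≤ τ) (n : ℕ) {x y : WithTop B} (hxy : x ≤ y) :
    σ.update n x ≤ τ.update n y := by
  intro m
  by_cases hm : m = n
  · subst hm
    exact (update_self σ m x).le.trans (hxy.trans (update_self τ m y).ge)
  · exact (update_of_ne σ hm x).le.trans ((h m).trans (update_of_ne τ hm y).ge)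

theorem le_update_iff {σ τ : FiniteCondition B} {n : ℕ} {x : WithTop B} :
    σ ≤ τ.update n x ↔ σ.1 n ≤ x ∧ ∀ m, m ≠ n → σ.1 m ≤ τ.1 m := by
  constructor
  · intro h
    refine ⟨(h n).trans (update_self τ n x).le, fun m hm => (h m).trans (update_of_ne τ hm x).le⟩
  · rintro ⟨h₁, h₂⟩ m
    by_cases hm : m = n
    · subst hm
      exact h₁.trans (update_self τ m x).ge
    · exact (h₂ m hm).trans (update_of_ne τ hm x).ge

theorem update_le_update_of_le {σ τ : FiniteCondition B} {n : ℕ} {x y x' : WithTop B}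
    (h : σ ≤ τ.update n x) (hy : y ≤ x') : σ.update n y ≤ τ.update n x' :=
  le_update_iff.2 ⟨(update_self σ n y).le.trans hy, fun m hm =>
    (update_of_ne σ hm y).le.trans ((le_update_iff.1 h).2 m hm)⟩

theorem update_le_self {σ : FiniteCondition B} {n : ℕ} {x : WithTop B} (h : x ≤ σ.1 n) :
    σ.update n x ≤ σ := by
  conv_rhs => rw [← σ.update_eq_self n]
  exact update_mono le_rfl n h

/-- The single requirement `f(n) ∈ x`. -/
def single (n : ℕ) (x : WithTop B) : FiniteCondition B := update ⊤ n x

@[simp] theorem single_top (n : ℕ) : single n (⊤ : WithTop B) = ⊤ :=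
  update_eq_self (⊤ : FiniteCondition B) n

theorem inf_single (σ : FiniteCondition B) (n : ℕ) (x : WithTop B) :
    σ ⊓ single n x = σ.update n (σ.1 n ⊓ x) := by
  refine Subtype.ext (funext fun m => ?_)
  by_cases hm : m = n
  · subst hm
    rw [inf_apply, single, update_self, update_self]
  · rw [inf_apply, single, update_of_ne _ hm, update_of_ne _ hm, top_apply, inf_top_eq]

theorem single_inf_single (n : ℕ) (x y : WithTop B) :
    single n x ⊓ single n y = single n (x ⊓ y) := by
  rw [inf_single, single, update_self]
  refine Subtype.ext (funext fun m => ?_)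
  by_cases hm : m = n
  · subst hm
    rw [update_self, single, update_self]
  · rw [update_of_ne _ hm, single, update_of_ne _ hm, update_of_ne _ hm]

theorem eq_finset_inf_single (σ : FiniteCondition B) :
    σ = σ.2.toFinset.inf fun n => single n (σ.1 n) := by
  apply le_antisymm
  · refine Finset.le_inf fun n _ => le_update_iff.2 ⟨le_rfl, fun _ _ => le_top⟩
  · intro n
    by_cases hn : σ.1 n = ⊤
    · rw [hn]
      exact le_top
    · have h : (σ.2.toFinset.inf fun n => single n (σ.1 n)) ≤ single n (σ.1 n) :=
        Finset.inf_le (σ.2.mem_toFinset.2 hn)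
      exact (h n).trans (update_self _ _ _).le

end FiniteCondition

/-! ### The frame presented by finite conditions -/

section Enumeration

variable {A B : Type u} [Order.Frame A] [Order.Frame B] (f : FrameHom A B) (l : B → A)

/-- The frame of the locale of partial surjections from `ℕ` onto the fibres of a locale morphism
with inverse image `f` and direct image `l`. -/
def enumerationFrame : Sublocale (LowerSet (A × FiniteCondition B)) where
  carrier := {D |
    -- The conditions express, in order: joins in the base, joins in each value, linearity over the
    -- base, and surjectivity (over `l b` some `n` has its value in `b`). Single-valuedness needs no
    -- clause, since meets of conditions are taken coordinatewise. Values range over `B`, not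
    -- `WithTop B`: requiring the top element of `B` says that `f(n)` is defined, whereas the added
    -- `⊤` says nothing.
    (∀ (S : Set A) (σ : FiniteCondition B), (∀ a ∈ S, (a, σ) ∈ D) → (sSup S, σ) ∈ D) ∧
    (∀ (a : A) (σ : FiniteCondition B) (n : ℕ) (S : Set B),
      (∀ b ∈ S, (a, σ.update n b) ∈ D) → (a, σ.update n (sSup S : B)) ∈ D) ∧
    (∀ (a c : A) (σ : FiniteCondition B) (n : ℕ) (b : B),
      (a ⊓ c, σ.update n b) ∈ D ↔ (a, σ.update n (b ⊓ f c : B)) ∈ D) ∧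
    (∀ (a : A) (σ : FiniteCondition B) (b : B),
      (∀ n, (a, σ ⊓ FiniteCondition.single n b) ∈ D) → (a ⊓ l b, σ) ∈ D)}
  sInf_mem' := by
    intro s hs
    simp only [Set.mem_ofPred_eq, LowerSet.mem_sInf_iff]
    refine ⟨fun S σ h D hD => ?_, fun a σ n S h D hD => ?_, fun a c σ n b => ?_,
      fun a σ b h D hD => ?_⟩
    · exact (hs hD).1 S σ fun a ha => h a ha D hD
    · exact (hs hD).2.1 a σ n S fun b hb => h b hb D hD
    · exact forall₂_congr fun D hD => (hs hD).2.2.1 a c σ n b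
    · exact (hs hD).2.2.2 a σ b fun n => h n D hD
  himp_mem' := by
    have hmem : ∀ (E D : LowerSet (A × FiniteCondition B)) (x : A × FiniteCondition B),
        x ∈ E ⇨ D ↔ ∀ y ≤ x, y ∈ E → y ∈ D := by
      intro E D x
      rw [← LowerSet.Iic_le, le_himp_iff]
      constructor
      · intro h y hy hE
        exact h (show y ∈ LowerSet.Iic x ⊓ E from ⟨hy, hE⟩)
      · rintro h y ⟨hy, hE⟩
        exact h y hy hE
    rintro E D ⟨h₁, h₂, h₃, h₄⟩
    simp only [Set.mem_ofPred_eq, hmem]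
    -- Each relation must be stable under strengthening the condition, hence the arbitrary `σ` in
    -- all of them.
    refine ⟨?_, ?_, fun a c σ n b => ⟨?_, ?_⟩, ?_⟩
    · rintro S σ h ⟨a', σ'⟩ ⟨ha, hσ⟩ hE
      have key := h₁ ((fun s => a' ⊓ s) '' S) σ' (by
        rintro _ ⟨s, hs, rfl⟩
        exact h s hs _ ⟨inf_le_right, hσ⟩
          (E.lower (show ((a' ⊓ s, σ') : A × _) ≤ (a', σ') from ⟨inf_le_left, le_rfl⟩) hE))
      rw [sSup_image, ← inf_sSup_eq] at key
      rwa [inf_eq_left.2 ha] at key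
    · rintro a σ n S h ⟨a', σ'⟩ ⟨ha, hσ⟩ hE
      -- A condition below one that constrains `n` constrains `n` itself, so its entry is a genuine
      -- open `b'` and the relation for `D` applies there.
      obtain ⟨b', hb', hle⟩ := WithTop.le_coe_iff.1 (FiniteCondition.le_update_iff.1 hσ).1
      have key := h₂ a' σ' n ((fun s => b' ⊓ s) '' S) (by
        rintro _ ⟨s, hs, rfl⟩
        refine h s hs _ ⟨ha, FiniteCondition.update_le_update_of_le hσ
          (WithTop.coe_le_coe.2 inf_le_right)⟩ (E.lower (a := (a', σ')) ⟨le_rfl, ?_⟩ hE)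
        refine FiniteCondition.update_le_self ?_
        rw [hb']
        exact WithTop.coe_le_coe.2 inf_le_left)
      rw [sSup_image, ← inf_sSup_eq] at key
      rwa [inf_eq_left.2 hle, ← hb', FiniteCondition.update_eq_self] at key
    · rintro h ⟨a', σ'⟩ ⟨ha, hσ⟩ hE
      obtain ⟨b', hb', hle⟩ := WithTop.le_coe_iff.1 (FiniteCondition.le_update_iff.1 hσ).1
      have key := (h₃ a' c σ' n b').1 (by
        rw [← hb', FiniteCondition.update_eq_self]
        refine h _ ⟨inf_le_inf_right _ ha, ?_⟩ (E.lower (a := (a', σ')) ⟨inf_le_left, le_rfl⟩ hE)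
        exact hσ.trans (FiniteCondition.update_mono le_rfl n (WithTop.coe_le_coe.2 inf_le_left)))
      rwa [inf_eq_left.2 (hle.trans inf_le_right), ← hb', FiniteCondition.update_eq_self] at key
    · rintro h ⟨a', σ'⟩ ⟨ha, hσ⟩ hE
      obtain ⟨b', hb', hle⟩ := WithTop.le_coe_iff.1 (FiniteCondition.le_update_iff.1 hσ).1
      have ha' : a' ≤ a ⊓ c := ha
      have key := (h₃ a' c σ' n b').2 (by
        refine h _ ⟨ha'.trans inf_le_left, FiniteCondition.update_le_update_of_le hσ
          (WithTop.coe_le_coe.2 (inf_le_inf_right _ hle))⟩ (E.lower (a := (a', σ')) ⟨le_rfl, ?_⟩ hE)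
        refine FiniteCondition.update_le_self ?_
        rw [hb']
        exact WithTop.coe_le_coe.2 inf_le_left)
      rwa [inf_eq_left.2 (ha'.trans inf_le_right), ← hb', FiniteCondition.update_eq_self] at key
    · rintro a σ b h ⟨a', σ'⟩ ⟨ha, hσ⟩ hE
      have ha' : a' ≤ a ⊓ l b := ha
      have key := h₄ a' σ' b fun n => h n _
        ⟨ha'.trans inf_le_left, inf_le_inf_right (FiniteCondition.single n (b : WithTop B)) hσ⟩
        (E.lower (a := (a', σ')) ⟨le_rfl, inf_le_left⟩ hE)
      rwa [inf_eq_left.2 (ha'.trans inf_le_right)] at key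

/-- The basic open given by a finite condition, restricted to an open of the base. -/
def basicOpen (x : A × FiniteCondition B) : enumerationFrame f l :=
  (enumerationFrame f l).restrict (LowerSet.Iic x)

variable {f l}

theorem basicOpen_le_iff {x : A × FiniteCondition B} {D : enumerationFrame f l} :
    basicOpen f l x ≤ D ↔ x ∈ (D : LowerSet (A × FiniteCondition B)) := by
  rw [basicOpen, (enumerationFrame f l).giRestrict.gc _ _, LowerSet.Iic_le]

theorem mem_basicOpen (x : A × FiniteCondition B) :
    x ∈ (basicOpen f l x : LowerSet (A × FiniteCondition B)) := basicOpen_le_iff.1 le_rfl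

theorem basicOpen_inf (x y : A × FiniteCondition B) :
    basicOpen f l (x ⊓ y) = basicOpen f l x ⊓ basicOpen f l y := by
  rw [basicOpen, basicOpen, basicOpen, ← map_inf]
  congr 1
  ext z
  simp

theorem basicOpen_mono : Monotone (basicOpen f l) := fun _ _ h =>
  basicOpen_le_iff.2 (LowerSet.lower _ h (mem_basicOpen _))

theorem basicOpen_top : basicOpen f l ⊤ = ⊤ :=
  top_unique ((enumerationFrame f l).restrict.map_top' ▸
    OrderHomClass.mono (enumerationFrame f l).restrict
      fun x _ => (le_top : x ≤ (⊤ : A × FiniteCondition B)))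

theorem eq_sSup_basicOpen (D : enumerationFrame f l) :
    D = sSup (basicOpen f l '' (D : LowerSet (A × FiniteCondition B))) := by
  apply le_antisymm
  · intro x hx
    exact basicOpen_le_iff.1 (le_sSup ⟨x, hx, rfl⟩)
  · refine sSup_le ?_
    rintro _ ⟨x, hx, rfl⟩
    exact basicOpen_le_iff.2 hx

variable (f l) in
/-- The inverse image of the projection to the base. -/
def baseHom : FrameHom A (enumerationFrame f l) where
  toFun a := basicOpen f l (a, ⊤)
  map_inf' a b := by
    rw [← basicOpen_inf, Prod.mk_inf_mk, inf_idem]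
  map_top' := basicOpen_top
  map_sSup' S := by
    apply le_antisymm
    · rw [basicOpen_le_iff]
      refine (sSup ((fun a => basicOpen f l (a, ⊤)) '' S)).2.1 S ⊤ fun a ha => ?_
      exact basicOpen_le_iff.1 (le_sSup ⟨a, ha, rfl⟩)
    · refine sSup_le ?_
      rintro _ ⟨a, ha, rfl⟩
      exact basicOpen_mono ⟨le_sSup ha, le_rfl⟩

variable (f l) in
/-- The open `[f(n) ∈ b]`. -/
def valueOpen (n : ℕ) (b : B) : enumerationFrame f l :=
  basicOpen f l (⊤, FiniteCondition.single n b)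

/-! ### The universal property of the frame -/

variable {Z : Type u} [Order.Frame Z]

/-- Extend a function by sending the added top element to `⊤`. -/
def extendTop {B : Type u} (φ : B → Z) : WithTop B → Z := WithTop.recTopCoe ⊤ φ

@[simp] theorem extendTop_top {B : Type u} (φ : B → Z) : extendTop φ ⊤ = ⊤ := rfl

@[simp] theorem extendTop_coe {B : Type u} (φ : B → Z) (b : B) : extendTop φ b = φ b := rfl

theorem extendTop_mono {φ : B → Z} (h : Monotone φ) : Monotone (extendTop φ) := by
  intro x y hxy
  induction y with
  | top => exact le_top
  | coe y =>
    obtain ⟨x, rfl, hle⟩ := WithTop.le_coe_iff.1 hxy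
    exact h hle

theorem extendTop_inf {φ : B → Z} (h : ∀ b c, φ (b ⊓ c) = φ b ⊓ φ c) (x y : WithTop B) :
    extendTop φ (x ⊓ y) = extendTop φ x ⊓ extendTop φ y := by
  induction x with
  | top => simp
  | coe x =>
    induction y with
    | top => simp
    | coe y => rw [← WithTop.coe_inf]; exact h x y

/-- The truth value of a condition, given the truth values `φ n b` of `f(n) ∈ b`. -/
def conditionValue {A : Type u} (h : A → Z) (φ : ℕ → B → Z) (x : A × FiniteCondition B) : Z :=
  h x.1 ⊓ ⨅ n, extendTop (φ n) (x.2.1 n)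

/-- Isolating coordinate `n` as one factor of a binary meet allows frame distributivity to be
applied to it, although the value is an infimum over all of `ℕ`. -/
theorem conditionValue_update {A : Type u} (h : A → Z) (φ : ℕ → B → Z) (a : A) (σ : FiniteCondition B) (n : ℕ)
    (x : WithTop B) : conditionValue h φ (a, σ.update n x) =
      h a ⊓ (extendTop (φ n) x ⊓ ⨅ (m) (_ : m ≠ n), extendTop (φ m) (σ.1 m)) := by
  unfold conditionValue
  congr 1
  apply le_antisymm
  · refine le_inf ((iInf_le _ n).trans (by rw [FiniteCondition.update_self])) ?_
    refine le_iInf₂ fun m hm => (iInf_le _ m).trans ?_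
    rw [FiniteCondition.update_of_ne _ hm]
  · refine le_iInf fun m => ?_
    by_cases hm : m = n
    · subst hm
      rw [FiniteCondition.update_self]
      exact inf_le_left
    · rw [FiniteCondition.update_of_ne _ hm]
      exact inf_le_right.trans (iInf₂_le m hm)

theorem conditionValue_mono {h : A → Z} {φ : ℕ → B → Z} (hh : Monotone h)
    (hφ : ∀ n, Monotone (φ n)) : Monotone (conditionValue h φ) := fun _ _ hxy =>
  inf_le_inf (hh hxy.1) (iInf_mono fun n => extendTop_mono (hφ n) (hxy.2 n))

theorem conditionValue_inf {φ : ℕ → B → Z} (h : FrameHom A Z)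
    (hφ : ∀ n b c, φ n (b ⊓ c) = φ n b ⊓ φ n c) (x y : A × FiniteCondition B) :
    conditionValue h φ (x ⊓ y) = conditionValue h φ x ⊓ conditionValue h φ y := by
  unfold conditionValue
  have : ∀ n, extendTop (φ n) ((x ⊓ y).2.1 n) =
      extendTop (φ n) (x.2.1 n) ⊓ extendTop (φ n) (y.2.1 n) :=
    fun n => extendTop_inf (hφ n) _ _
  simp only [this]
  rw [iInf_inf_eq, Prod.fst_inf, map_inf, inf_inf_inf_comm]

/-- The extension of a truth value assignment to the frame `enumerationFrame f l`. -/
def descFun (h : A → Z) (φ : ℕ → B → Z) (D : enumerationFrame f l) : Z :=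
  sSup (conditionValue h φ '' (D : LowerSet (A × FiniteCondition B)))

/-- The right adjoint sends `z` to the set of conditions of value at most `z`; the hypotheses are
what is needed for this set to satisfy the relations. Preservation of meets by `φ` is not required,
so the lemma serves both the classifying homomorphisms and the direct image of the projection, where
`φ n = l`. -/
theorem descFun_exists_adjoint (h : FrameHom A Z) (φ : ℕ → B → Z)
    (hsSup : ∀ n (S : Set B), φ n (sSup S) = sSup (φ n '' S))
    (hlin : ∀ n b c, φ n (b ⊓ f c) = φ n b ⊓ h c)
    (hcov : ∀ (a : A) (σ : FiniteCondition B) (b : B) (z : Z),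
      (∀ n, conditionValue h φ (a, σ ⊓ FiniteCondition.single n b) ≤ z) →
      conditionValue h φ (a ⊓ l b, σ) ≤ z) :
    ∃ r : Z → enumerationFrame f l, GaloisConnection (descFun h φ) r ∧
      ∀ z x, x ∈ (r z : LowerSet (A × FiniteCondition B)) ↔ conditionValue h φ x ≤ z := by
  have hmono : ∀ n, Monotone (φ n) := by
    intro n b c hbc
    have := hsSup n {b, c}
    rw [sSup_pair, sup_eq_right.2 hbc, Set.image_pair, sSup_pair] at this
    rw [this]
    exact le_sup_left
  refine ⟨fun z => ⟨⟨{x | conditionValue h φ x ≤ z}, ?_⟩, ?_, ?_, ?_, ?_⟩, ?_, fun z x => Iff.rfl⟩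
  · intro x y hyx hx
    exact (conditionValue_mono (OrderHomClass.mono h) hmono hyx).trans hx
  · intro S σ hS
    change h (sSup S) ⊓ _ ≤ z
    rw [map_sSup, sSup_inf_eq]
    refine iSup₂_le ?_
    rintro _ ⟨b, hb, rfl⟩
    exact hS b hb
  · intro a σ n S hS
    change conditionValue h φ _ ≤ z
    rw [conditionValue_update, extendTop_coe, hsSup, sSup_inf_eq, inf_iSup₂_eq]
    refine iSup₂_le ?_
    rintro _ ⟨b, hb, rfl⟩
    have : conditionValue h φ (a, σ.update n b) ≤ z := hS b hb
    rwa [conditionValue_update] at this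
  · intro a c σ n b
    change conditionValue h φ _ ≤ z ↔ conditionValue h φ _ ≤ z
    rw [conditionValue_update, conditionValue_update, extendTop_coe, extendTop_coe, hlin, map_inf,
      inf_assoc, inf_left_comm (h c), inf_assoc]
  · intro a σ b hb
    exact hcov a σ b z hb
  · intro D z
    constructor
    · intro hD x hx
      have hle : conditionValue h φ x ≤ descFun h φ D := le_sSup ⟨x, hx, rfl⟩
      exact hle.trans hD
    · intro hD
      refine sSup_le ?_
      rintro _ ⟨x, hx, rfl⟩
      exact hD hx

variable (f l) in
/-- The truth values `φ n b` of `f(n) ∈ b` for a partial surjection `f` from `ℕ` onto the fibre over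
a generalised point with inverse image `h`. -/
structure IsEnumeration (h : FrameHom A Z) (φ : ℕ → B → Z) : Prop where
  value_sSup : ∀ n (S : Set B), φ n (sSup S) = sSup (φ n '' S)
  value_inf : ∀ n b c, φ n (b ⊓ c) = φ n b ⊓ φ n c
  linear : ∀ n b c, φ n (b ⊓ f c) = φ n b ⊓ h c
  surjective : ∀ b, ⨆ n, φ n b = h (l b)

theorem IsEnumeration.exists_adjoint {h : FrameHom A Z} {φ : ℕ → B → Z}
    (H : IsEnumeration f l h φ) :
    ∃ r : Z → enumerationFrame f l, GaloisConnection (descFun h φ) r ∧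
      ∀ z x, x ∈ (r z : LowerSet (A × FiniteCondition B)) ↔ conditionValue h φ x ≤ z := by
  refine descFun_exists_adjoint h φ H.value_sSup H.linear fun a σ b z hz => ?_
  have hle : conditionValue h φ (a ⊓ l b, σ) = ⨆ n, conditionValue h φ (a, σ) ⊓ φ n b := by
    rw [← inf_iSup_eq, H.surjective]
    change h (a ⊓ l b) ⊓ _ = h a ⊓ _ ⊓ _
    rw [map_inf, inf_right_comm]
  rw [hle]
  refine iSup_le fun n => le_trans ?_ (hz n)
  have : ((a, σ ⊓ FiniteCondition.single n b) : A × FiniteCondition B) =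
      (a, σ) ⊓ (⊤, FiniteCondition.single n b) := by
    rw [Prod.mk_inf_mk, inf_top_eq]
  rw [this, conditionValue_inf h H.value_inf]
  refine inf_le_inf_left _ ?_
  rw [FiniteCondition.single, conditionValue_update, extendTop_coe, map_top, top_inf_eq]
  refine le_inf le_rfl (le_iInf₂ fun m _ => le_top)

/-- The frame homomorphism classifying a partial surjection. -/
def IsEnumeration.desc {h : FrameHom A Z} {φ : ℕ → B → Z} (H : IsEnumeration f l h φ) :
    FrameHom (enumerationFrame f l) Z where
  toFun := descFun h φ
  map_inf' D E := by
    obtain ⟨r, hr, -⟩ := H.exists_adjoint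
    apply le_antisymm
    · exact hr.monotone_l.map_inf_le D E
    · unfold descFun
      rw [sSup_inf_sSup]
      refine iSup₂_le ?_
      rintro ⟨_, _⟩ ⟨⟨x, hx, rfl⟩, ⟨y, hy, rfl⟩⟩
      have hxy : x ⊓ y ∈ ((D ⊓ E : enumerationFrame f l) : LowerSet (A × FiniteCondition B)) :=
        ⟨LowerSet.lower _ (inf_le_left : x ⊓ y ≤ x) hx,
          LowerSet.lower _ (inf_le_right : x ⊓ y ≤ y) hy⟩
      exact (conditionValue_inf h H.value_inf x y).ge.trans (le_sSup ⟨x ⊓ y, hxy, rfl⟩)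
  map_top' := by
    refine top_unique (le_sSup ⟨⊤, basicOpen_le_iff.1 le_top, ?_⟩)
    simp [conditionValue]
  map_sSup' S := by
    obtain ⟨r, hr, -⟩ := H.exists_adjoint
    rw [hr.l_sSup, sSup_image]

theorem IsEnumeration.desc_basicOpen {h : FrameHom A Z} {φ : ℕ → B → Z}
    (H : IsEnumeration f l h φ) (x : A × FiniteCondition B) :
    H.desc (basicOpen f l x) = conditionValue h φ x := by
  obtain ⟨r, hr, hm⟩ := H.exists_adjoint
  refine eq_of_forall_ge_iff fun z => ?_
  change descFun h φ _ ≤ z ↔ _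
  rw [hr _ _, basicOpen_le_iff, hm]

theorem IsEnumeration.desc_baseHom {h : FrameHom A Z} {φ : ℕ → B → Z}
    (H : IsEnumeration f l h φ) (a : A) : H.desc (baseHom f l a) = h a := by
  refine (H.desc_basicOpen (a, ⊤)).trans ?_
  simp [conditionValue]

theorem IsEnumeration.desc_valueOpen {h : FrameHom A Z} {φ : ℕ → B → Z}
    (H : IsEnumeration f l h φ) (n : ℕ) (b : B) : H.desc (valueOpen f l n b) = φ n b := by
  refine (H.desc_basicOpen _).trans ?_
  rw [FiniteCondition.single, conditionValue_update, extendTop_coe, map_top, top_inf_eq]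
  simp

/-- Finiteness of the support turns a basic open into a finite meet of generators, which a frame
homomorphism must preserve. -/
theorem basicOpen_eq (x : A × FiniteCondition B) : basicOpen f l x =
    baseHom f l x.1 ⊓ x.2.2.toFinset.inf
      fun n => basicOpen f l (⊤, FiniteCondition.single n (x.2.1 n)) := by
  have h : ∀ s : Finset ℕ, basicOpen f l (⊤, s.inf fun n => FiniteCondition.single n (x.2.1 n)) =
      s.inf fun n => basicOpen f l (⊤, FiniteCondition.single n (x.2.1 n)) := by
    intro s
    induction s using Finset.induction_on with
    | empty => exact basicOpen_top
    | insert n s hn ih =>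
      rw [Finset.inf_insert, Finset.inf_insert, ← ih, ← basicOpen_inf, Prod.mk_inf_mk, inf_idem]
  rw [← h, ← FiniteCondition.eq_finset_inf_single]
  change _ = basicOpen f l _ ⊓ _
  rw [← basicOpen_inf, Prod.mk_inf_mk, inf_top_eq, top_inf_eq]

theorem enumerationFrame_hom_ext {t t' : FrameHom (enumerationFrame f l) Z}
    (h₁ : ∀ a, t (baseHom f l a) = t' (baseHom f l a))
    (h₂ : ∀ n b, t (valueOpen f l n b) = t' (valueOpen f l n b)) : t = t' := by
  have h₃ : ∀ n x, t (basicOpen f l (⊤, FiniteCondition.single n x)) =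
      t' (basicOpen f l (⊤, FiniteCondition.single n x)) := by
    intro n x
    induction x with
    | top =>
      rw [FiniteCondition.single_top, show ((⊤, ⊤) : A × FiniteCondition B) = ⊤ from rfl,
        basicOpen_top, map_top, map_top]
    | coe b => exact h₂ n b
  refine FrameHom.ext fun D => ?_
  rw [eq_sSup_basicOpen D, map_sSup, map_sSup, Set.image_image, Set.image_image]
  congr 1
  refine Set.image_congr fun x _ => ?_
  rw [basicOpen_eq, map_inf, map_inf, map_finset_inf, map_finset_inf, h₁]
  congr 1
  exact Finset.inf_congr rfl fun n _ => h₃ n _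

theorem valueOpen_linear (n : ℕ) (b : B) (c : A) :
    valueOpen f l n (b ⊓ f c) = valueOpen f l n b ⊓ baseHom f l c := by
  change basicOpen f l _ = basicOpen f l _ ⊓ basicOpen f l _
  rw [← basicOpen_inf, Prod.mk_inf_mk, inf_top_eq]
  refine eq_of_forall_ge_iff fun D => ?_
  rw [basicOpen_le_iff, basicOpen_le_iff]
  exact (D.2.2.2.1 ⊤ c ⊤ n b).symm

/-- The generic enumeration, of which every other one is an image. The unit `b ≤ f (l b)` gives the
upper bound in surjectivity: by linearity, `f(n) ∈ b` already forces `l b` in the base. -/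
theorem valueOpen_isEnumeration (hl : ∀ b, b ≤ f (l b)) :
    IsEnumeration f l (baseHom f l) (valueOpen f l) where
  value_sSup n S := by
    apply le_antisymm
    · rw [valueOpen, basicOpen_le_iff]
      refine (sSup (valueOpen f l n '' S)).2.2.1 ⊤ ⊤ n S fun b hb => ?_
      exact basicOpen_le_iff.1 (le_sSup ⟨b, hb, rfl⟩)
    · refine sSup_le ?_
      rintro _ ⟨b, hb, rfl⟩
      exact basicOpen_mono ⟨le_rfl, FiniteCondition.update_mono le_rfl n
        (WithTop.coe_le_coe.2 (le_sSup hb))⟩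
  value_inf n b c := by
    rw [valueOpen, valueOpen, valueOpen, ← basicOpen_inf, Prod.mk_inf_mk, inf_idem,
      FiniteCondition.single_inf_single, WithTop.coe_inf]
  linear := valueOpen_linear
  surjective b := by
    apply le_antisymm
    · refine iSup_le fun n => ?_
      have hb : valueOpen f l n b = valueOpen f l n b ⊓ baseHom f l (l b) := by
        rw [← valueOpen_linear, inf_eq_left.2 (hl b)]
      exact hb.le.trans inf_le_right
    · change basicOpen f l _ ≤ _
      rw [basicOpen_le_iff]
      have key := (⨆ n, valueOpen f l n b).2.2.2.2 ⊤ ⊤ b fun n => by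
        rw [top_inf_eq]
        exact basicOpen_le_iff.1 (le_iSup (fun n => valueOpen f l n b) n)
      rwa [top_inf_eq] at key

theorem IsEnumeration.comp {h : FrameHom A Z} {φ : ℕ → B → Z} (H : IsEnumeration f l h φ)
    {W : Type u} [Order.Frame W] (t : FrameHom Z W) :
    IsEnumeration f l (t.comp h) fun n b => t (φ n b) where
  value_sSup n S := by rw [H.value_sSup, map_sSup, Set.image_image]
  value_inf n b c := by rw [H.value_inf, map_inf]
  linear n b c := by rw [H.linear, map_inf]; rfl
  surjective b := by rw [← map_iSup, H.surjective]; rfl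

/-! ### Openness and surjectivity of the projection to the base -/

/-- Since `b = b ⊓ f (l b)`, linearity lets a requirement with value `b` absorb the restriction of
the base to `l b`. This is repeated over the finite support. -/
theorem mem_of_conditionValue_mem (hl : ∀ b, b ≤ f (l b)) (D : enumerationFrame f l) (a : A)
    (σ : FiniteCondition B)
    (h : (conditionValue id (fun _ => l) (a, σ), σ) ∈ (D : LowerSet (A × FiniteCondition B))) :
    (a, σ) ∈ (D : LowerSet (A × FiniteCondition B)) := by
  have key : ∀ s : Finset ℕ, (a ⊓ s.inf (fun n => extendTop l (σ.1 n)), σ) ∈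
      (D : LowerSet (A × FiniteCondition B)) → (a, σ) ∈ (D : LowerSet (A × FiniteCondition B)) := by
    intro s
    induction s using Finset.induction_on with
    | empty => simp
    | insert n s hn ih =>
      intro hD
      apply ih
      rw [Finset.inf_insert, inf_left_comm, inf_comm] at hD
      cases hσ : σ.1 n with
      | top =>
        rw [hσ] at hD
        simpa using hD
      | coe b =>
        rw [hσ] at hD
        have h₃ := (D.2.2.2.1 (a ⊓ s.inf fun n => extendTop l (σ.1 n)) (l b) σ n b).1
        rw [inf_eq_left.2 (hl b)] at h₃
        have hu : σ.update n (b : WithTop B) = σ :=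
          (congrArg (σ.update n) hσ.symm).trans (σ.update_eq_self n)
        rw [hu] at h₃
        exact h₃ hD
  refine key σ.2.toFinset (LowerSet.lower _ (?_ : (_, σ) ≤ (_, σ)) h)
  refine Prod.mk_le_mk.2 ⟨inf_le_inf_left a (le_iInf fun n => ?_), le_rfl⟩
  by_cases hn : σ.1 n = ⊤
  · simp [hn]
  · exact Finset.inf_le (f := fun n => extendTop l (σ.1 n)) (σ.2.mem_toFinset.2 hn)

/-- The candidate direct image of the projection respects the relations. Joins come from the
adjunction and linearity from Frobenius; surjectivity is where finiteness of conditions enters. -/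
theorem conditionValue_directImage_exists_adjoint (gc : GaloisConnection l f)
    (hfrob : ∀ a b, l (f a ⊓ b) = a ⊓ l b) :
    ∃ r : A → enumerationFrame f l, GaloisConnection (descFun id fun _ => l) r ∧
      ∀ a x, x ∈ (r a : LowerSet (A × FiniteCondition B)) ↔
        conditionValue id (fun _ => l) x ≤ a := by
  refine descFun_exists_adjoint (FrameHom.id A) (fun _ => l) (fun _ S => ?_) (fun _ b c => ?_)
    fun a σ b z hz => ?_
  · rw [gc.l_sSup, sSup_image]
  · rw [inf_comm, hfrob, inf_comm]
    rfl
  -- At an index `n` left free by `σ`, adding the requirement `b` multiplies the value by exactly `l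
  -- b`, so this single `n` already gives the bound.
  · obtain ⟨n, hn⟩ := σ.2.exists_notMem
    have hn : σ.1 n = ⊤ := by simpa using hn
    refine le_trans (le_of_eq ?_) (hz n)
    have h₁ := conditionValue_update id (fun _ => l) a σ n (σ.1 n)
    rw [σ.update_eq_self, hn, extendTop_top, top_inf_eq] at h₁
    rw [FiniteCondition.inf_single, hn, top_inf_eq]
    refine Eq.trans ?_ (conditionValue_update id (fun _ => l) a σ n b).symm
    change a ⊓ l b ⊓ _ = _
    change a ⊓ _ = _ at h₁
    rw [inf_right_comm, h₁, extendTop_coe, inf_assoc, inf_comm (l b)]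

/-- This identifies the inverse image of the projection with the right adjoint of the candidate
direct image. -/
theorem mem_baseHom_iff (gc : GaloisConnection l f) (hfrob : ∀ a b, l (f a ⊓ b) = a ⊓ l b) (a : A)
    (x : A × FiniteCondition B) : x ∈ (baseHom f l a : LowerSet (A × FiniteCondition B)) ↔
      conditionValue id (fun _ => l) x ≤ a := by
  obtain ⟨r, -, hr⟩ := conditionValue_directImage_exists_adjoint gc hfrob
  constructor
  · rw [← hr]
    intro hx
    have : baseHom f l a ≤ r a := basicOpen_le_iff.2 ((hr a _).2 inf_le_left)
    exact this hx
  · intro hx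
    refine mem_of_conditionValue_mem gc.le_u_l _ x.1 x.2 ?_
    exact LowerSet.lower _ (⟨hx, le_top⟩ : _ ≤ (a, (⊤ : FiniteCondition B))) (mem_basicOpen (a, ⊤))

theorem baseHom_injective (gc : GaloisConnection l f) (hfrob : ∀ a b, l (f a ⊓ b) = a ⊓ l b) :
    Function.Injective (baseHom f l) := by
  have h : ∀ a b, baseHom f l a ≤ baseHom f l b → a ≤ b := by
    intro a b hab
    have := (mem_baseHom_iff gc hfrob b (a, ⊤)).1 (hab (mem_basicOpen (a, ⊤)))
    simpa [conditionValue] using this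
  exact fun a b hab => le_antisymm (h a b hab.le) (h b a hab.ge)

theorem baseHom_exists_adjoint (gc : GaloisConnection l f)
    (hfrob : ∀ a b, l (f a ⊓ b) = a ⊓ l b) :
    ∃ m : enumerationFrame f l → A, GaloisConnection m (baseHom f l) ∧
      ∀ a D, m (baseHom f l a ⊓ D) = a ⊓ m D := by
  obtain ⟨r, hgc, hr⟩ := conditionValue_directImage_exists_adjoint gc hfrob
  have hgc : GaloisConnection (descFun id fun _ => l) (baseHom f l) := by
    intro D a
    rw [hgc D a]
    refine forall_congr' fun x => ?_
    exact imp_congr_right fun _ => (hr a x).trans (mem_baseHom_iff gc hfrob a x).symm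
  refine ⟨_, hgc, fun a D => le_antisymm ?_ ?_⟩
  · exact le_inf ((hgc _ _).2 inf_le_left) (hgc.monotone_l inf_le_right)
  · change a ⊓ sSup _ ≤ _
    rw [inf_sSup_eq]
    refine iSup₂_le ?_
    rintro _ ⟨x, hx, rfl⟩
    -- Meeting `x` with `(a, ⊤)` changes only its base component, which gives the nontrivial half of
    -- Frobenius.
    refine le_trans (le_of_eq ?_) (le_sSup ⟨(a, ⊤) ⊓ x, ⟨?_, ?_⟩, rfl⟩)
    · unfold conditionValue
      simp [inf_assoc]
    · exact LowerSet.lower _ inf_le_left (mem_basicOpen (a, (⊤ : FiniteCondition B)))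
    · exact LowerSet.lower _ inf_le_right hx

end Enumeration

/-! ### Direct images and base change -/

theorem inv_mono {X Y : Locale.{u}} (f : X ⟶ Y) : Monotone (inv f) := OrderHomClass.mono (inv f)

/-- The direct image `f_! : O X → O Y`; it is left adjoint to `f^*` when `f` is open. -/
def directImage {X Y : Locale.{u}} (f : X ⟶ Y) (v : X) : Y := sInf {u | v ≤ inv f u}

theorem directImage_eq {X Y : Locale.{u}} {f : X ⟶ Y} {l : X → Y}
    (gc : GaloisConnection l (inv f)) : directImage f = l := by
  funext v
  exact le_antisymm (sInf_le (gc.le_u_l v)) (le_sInf fun u hu => gc.l_le hu)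

namespace IsOpenMap

variable {X Y : Locale.{u}} {f : X ⟶ Y}

theorem gc (hf : IsOpenMap f) : GaloisConnection (directImage f) (inv f) := by
  obtain ⟨l, hl, -⟩ := hf
  rwa [directImage_eq hl]

theorem frobenius (hf : IsOpenMap f) (u : Y) (v : X) :
    directImage f (inv f u ⊓ v) = u ⊓ directImage f v := by
  obtain ⟨l, hl, h⟩ := hf
  rw [directImage_eq hl]
  exact h u v

theorem le_inv_directImage (hf : IsOpenMap f) (v : X) : v ≤ inv f (directImage f v) :=
  hf.gc.le_u_l v

end IsOpenMap

section Pullback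

variable {X H Y U : Locale.{u}} {s : Y ⟶ X} {r : Y ⟶ U} {p : X ⟶ H} {h : U ⟶ H}

/-- Transfers the explicit generators `u ⊗ b` to an arbitrary pullback square, so that claims about
its opens can be checked on rectangles. -/
theorem isPullback_pushoutFrame (sq : IsPullback s r p h) :
    ∃ (i : FrameHom (pushoutFrame (inv p) (inv h)) Y)
      (j : FrameHom Y (pushoutFrame (inv p) (inv h))),
      (∀ D, j (i D) = D) ∧ (∀ y, i (j y) = y) ∧
      (∀ u b, i (pushoutTmul (inv p) (inv h) u b) = inv s u ⊓ inv r b) := by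
  let e := sq.isLimit.conePointUniqueUpToIso (pullbackConeOfFramesIsLimit p h)
  have h₁ : e.hom ≫ (pullbackConeOfFrames p h).fst = s :=
    sq.isLimit.conePointUniqueUpToIso_hom_comp (pullbackConeOfFramesIsLimit p h) WalkingCospan.left
  have h₂ : e.hom ≫ (pullbackConeOfFrames p h).snd = r :=
    sq.isLimit.conePointUniqueUpToIso_hom_comp (pullbackConeOfFramesIsLimit p h) WalkingCospan.right
  let i : FrameHom (pushoutFrame (inv p) (inv h)) Y := inv e.hom
  refine ⟨i, inv e.inv, fun D => ?_, fun y => ?_, fun u b => ?_⟩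
  · exact congrArg (fun t => inv t D) e.inv_hom_id
  · exact congrArg (fun t => inv t y) e.hom_inv_id
  · rw [← pushoutInl_inf_inr]
    refine (map_inf i (pushoutInl (inv p) (inv h) u)
      (pushoutInr (inv p) (inv h) b)).trans ?_
    congr 1
    · exact congrArg (fun t => inv t u) h₁
    · exact congrArg (fun t => inv t b) h₂

theorem isPullback_induction (sq : IsPullback s r p h) {P : Y → Prop}
    (hgen : ∀ u b, P (inv s u ⊓ inv r b)) (hsup : ∀ S : Set Y, (∀ y ∈ S, P y) → P (sSup S))
    (y : Y) : P y := by
  obtain ⟨i, j, -, hij, hi⟩ := isPullback_pushoutFrame sq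
  rw [← hij y, pushout_eq_sSup _ _ (j y), map_sSup]
  apply hsup
  rintro _ ⟨_, ⟨x, -, rfl⟩, rfl⟩
  rw [hi]
  exact hgen _ _

theorem isPullback_le_sSup (sq : IsPullback s r p h) (y : Y) :
    y ≤ sSup {z | z ≤ y ∧ ∃ u b, z = inv s u ⊓ inv r b} := by
  refine isPullback_induction sq (P := fun y => y ≤ sSup {z | z ≤ y ∧ ∃ u b, z = inv s u ⊓ inv r b})
    (fun u b => le_sSup ⟨le_rfl, u, b, rfl⟩) (fun S hS => sSup_le fun y hy => ?_) y
  exact (hS y hy).trans (sSup_le_sSup fun z hz => ⟨hz.1.trans (le_sSup hy), hz.2⟩)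

/-- Open maps are stable under pullback and satisfy the Beck-Chevalley condition. -/
theorem IsOpenMap.beckChevalley (hp : IsOpenMap p) (sq : IsPullback s r p h) :
    IsOpenMap r ∧ ∀ u b, directImage r (inv s u ⊓ inv r b) = inv h (directImage p u) ⊓ b := by
  obtain ⟨i, j, hji, hij, hi⟩ := isPullback_pushoutFrame sq
  let l : Y → U := fun y => sSup ((fun x : X × U => inv h (directImage p x.1) ⊓ x.2) ''
    {x | x ∈ (j y : LowerSet (X × U))})
  have hr : ∀ b, j (inv r b) = pushoutTmul (inv p) (inv h) ⊤ b := by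
    intro b
    rw [← hji (pushoutTmul (inv p) (inv h) ⊤ b), hi, map_top, top_inf_eq]
  have hle : ∀ (z : U) (u : X) (b : U), inv h (directImage p u) ⊓ b ≤ z ↔
      inv s u ⊓ inv r b ≤ inv r z := by
    intro z u b
    constructor
    · intro hz
      calc inv s u ⊓ inv r b
          ≤ inv s (inv p (directImage p u)) ⊓ inv r b :=
            inf_le_inf_right _ (inv_mono s (hp.le_inv_directImage u))
        _ = inv r (inv h (directImage p u)) ⊓ inv r b := by
            congr 1
            exact congrArg (fun t => inv t (directImage p u)) sq.w
        _ ≤ inv r z := by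
            rw [← map_inf]
            exact inv_mono r hz
    · intro hz
      -- The rectangles whose intended direct image lies below `z`. Frobenius for `p` makes this set
      -- balanced, hence an element of the pushout; it contains `⊤ ⊗ z`, and therefore `u ⊗ b`.
      let R : pushoutFrame (inv p) (inv h) :=
        ⟨⟨{x | inv h (directImage p x.1) ⊓ x.2 ≤ z}, fun x y hyx hx =>
            (inf_le_inf (inv_mono h (hp.gc.monotone_l hyx.1)) hyx.2).trans hx⟩,
          fun S c hS => by
            change inv h (directImage p (sSup S)) ⊓ c ≤ z
            rw [hp.gc.l_sSup, map_iSup₂, iSup₂_inf_eq]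
            exact iSup₂_le hS,
          fun b S hS => by
            change inv h (directImage p b) ⊓ sSup S ≤ z
            rw [inf_sSup_eq]
            exact iSup₂_le hS,
          fun a b c => by
            change inv h (directImage p (b ⊓ inv p a)) ⊓ c ≤ z ↔
              inv h (directImage p b) ⊓ (c ⊓ inv h a) ≤ z
            rw [inf_comm b, hp.frobenius, map_inf, inf_comm c, inf_left_comm, inf_assoc]⟩
      have h₁ : pushoutTmul (inv p) (inv h) ⊤ z ≤ R :=
        (pushoutTmul_le_iff _ _ _ _ _).2 (inf_le_right : inv h (directImage p ⊤) ⊓ z ≤ z)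
      have h₂ : pushoutTmul (inv p) (inv h) u b ≤ R := by
        refine le_trans ?_ h₁
        rw [← hji (pushoutTmul (inv p) (inv h) u b), hi, ← hr]
        exact OrderHomClass.mono j hz
      exact (pushoutTmul_le_iff _ _ _ _ _).1 h₂
  have hgc : GaloisConnection l (inv r) := by
    intro y z
    constructor
    · intro hz
      rw [← hij y, pushout_eq_sSup _ _ (j y), map_sSup]
      refine sSup_le ?_
      rintro _ ⟨_, ⟨x, hx, rfl⟩, rfl⟩
      rw [hi, ← hle]
      have hx' : inv h (directImage p x.1) ⊓ x.2 ≤ l y := le_sSup ⟨x, hx, rfl⟩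
      exact hx'.trans hz
    · intro hz
      refine sSup_le ?_
      rintro _ ⟨x, hx, rfl⟩
      refine (hle z x.1 x.2).2 (le_trans ?_ hz)
      rw [← hi, ← hij y]
      exact OrderHomClass.mono i ((pushoutTmul_le_iff _ _ _ _ _).2 hx)
  have hval : ∀ u b, l (inv s u ⊓ inv r b) = inv h (directImage p u) ⊓ b := fun u b =>
    eq_of_forall_ge_iff fun z => (hgc _ _).trans (hle z u b).symm
  refine ⟨⟨l, hgc, fun c y => ?_⟩, by rwa [directImage_eq hgc]⟩
  refine isPullback_induction sq (P := fun y => l (inv r c ⊓ y) = c ⊓ l y) (fun u b => ?_)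
    (fun S hS => ?_) y
  · rw [inf_left_comm, ← map_inf, hval, hval, inf_left_comm]
  · rw [inf_sSup_eq, hgc.l_iSup₂, hgc.l_sSup, inf_iSup₂_eq]
    exact iSup_congr fun y => iSup_congr fun hy => hS y hy

end Pullback

/-! ### The equality predicate -/

section EqPred

variable {Y U : Locale.{u}} {r : Y ⟶ U}

theorem inv_diagonal_fst (y : Y) : inv (pullback.diagonal r) (inv (pullback.fst r r) y) = y :=
  congrArg (fun t => inv t y) (pullback.diagonal_fst r)

theorem inv_diagonal_snd (y : Y) : inv (pullback.diagonal r) (inv (pullback.snd r r) y) = y :=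
  congrArg (fun t => inv t y) (pullback.diagonal_snd r)

/-- On `e` the first coordinate may be replaced by the second. Applied to rectangles, this gives `e
⊓ π₁^*(Δ^* d) ≤ d` for every `d`, and `Δ^* d = ⊤` when `d` contains the diagonal. -/
theorem le_eqPred {e : (pullback r r : Locale.{u})}
    (he : ∀ y, e ⊓ inv (pullback.fst r r) y ≤ inv (pullback.snd r r) y) : e ≤ eqPred r := by
  refine le_sInf fun d hd => ?_
  have key : e ⊓ inv (pullback.fst r r) (inv (pullback.diagonal r) d) ≤ d := by
    refine isPullback_induction (IsPullback.of_hasPullback r r)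
      (P := fun d => e ⊓ inv (pullback.fst r r) (inv (pullback.diagonal r) d) ≤ d)
      (fun y y' => ?_) (fun S hS => ?_) d
    · rw [map_inf, inv_diagonal_fst, inv_diagonal_snd, map_inf]
      exact le_inf (inf_le_right.trans inf_le_left)
        ((inf_le_inf_left e inf_le_right).trans (he y'))
    · rw [map_sSup, map_sSup, Set.image_image, inf_sSup_eq]
      refine iSup₂_le ?_
      rintro _ ⟨d, hd, rfl⟩
      exact (hS d hd).trans (le_sSup hd)
  have hd : inv (pullback.diagonal r) d = ⊤ := hd
  rwa [hd, map_top, inf_top_eq] at key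

/-- Substitution of equals: by Frobenius the left side is `Δ_!(y)`, and `y = Δ^*(π₂^* y)`. -/
theorem eqPred_inf_le (hr : IsOpenMap (pullback.diagonal r)) (y : Y) :
    eqPred r ⊓ inv (pullback.fst r r) y ≤ inv (pullback.snd r r) y := by
  rw [eqPred_eq r _ hr.gc, inf_comm, ← hr.frobenius, inf_top_eq]
  refine hr.gc.l_le ?_
  rw [inv_diagonal_fst, inv_diagonal_snd]

theorem inv_diagonal_eqPred (hr : IsOpenMap (pullback.diagonal r)) :
    inv (pullback.diagonal r) (eqPred r) = ⊤ := by
  rw [eqPred_eq r _ hr.gc]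
  exact top_unique (hr.le_inv_directImage ⊤)

/-- The opens on which `r` is a monomorphism, that is, the images of the local sections of `r`. -/
def IsSection (r : Y ⟶ U) (u : Y) : Prop :=
  ∀ w, u ⊓ inv r (directImage r (u ⊓ w)) ≤ w

theorem isSection_of_le_eqPred (hr : IsLocalHomeo r) {u : Y}
    (hu : inv (pullback.fst r r) u ⊓ inv (pullback.snd r r) u ≤ eqPred r) : IsSection r u := by
  intro w
  obtain ⟨h₁, h₂⟩ := hr.1.beckChevalley (IsPullback.of_hasPullback r r)
  rw [inf_comm, ← h₂]
  refine h₁.gc.l_le (le_trans ?_ (eqPred_inf_le hr.2 w))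
  rw [map_inf, inf_right_comm]
  exact inf_le_inf_right _ hu

/-- The open diagonal is a join of rectangles `π₁^* u ⊓ π₂^* v`; pulled back along `Δ` they become
opens `u ⊓ v` that cover `Y`, and the square of each still lies in the diagonal. -/
theorem iSup_isSection (hr : IsLocalHomeo r) : ⨆ u : {u // IsSection r u}, u.1 = ⊤ := by
  have h := inv_mono (pullback.diagonal r)
    (isPullback_le_sSup (IsPullback.of_hasPullback r r) (eqPred r))
  rw [inv_diagonal_eqPred hr.2, map_sSup] at h
  refine top_unique (h.trans (sSup_le ?_))
  rintro _ ⟨_, ⟨hle, u, v, rfl⟩, rfl⟩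
  rw [map_inf, inv_diagonal_fst, inv_diagonal_snd]
  refine le_iSup (fun u : {u // IsSection r u} => u.1)
    ⟨u ⊓ v, isSection_of_le_eqPred hr (le_trans ?_ hle)⟩
  exact inf_le_inf (inv_mono _ inf_le_left) (inv_mono _ inf_le_right)

end EqPred

/-! ### Partial surjections in terms of truth values -/

section Graph

variable {X H U : Locale.{u}} {p : X ⟶ H} {h : U ⟶ H}

theorem inv_fst_inv (a : H) :
    inv (pullback.fst p h) (inv p a) = inv (pullback.snd p h) (inv h a) :=
  congrArg (fun t => inv t a) pullback.condition

/-- Equality in the fibre implies equality of the images in `X`, where substitution is available. -/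
theorem eqPred_snd_inf_le (hp : IsLocalHomeo p) (u : X) :
    eqPred (pullback.snd p h) ⊓ inv (pullback.fst _ _) (inv (pullback.fst p h) u) ≤
      inv (pullback.snd _ _) (inv (pullback.fst p h) u) := by
  let k : pullback (pullback.snd p h) (pullback.snd p h) ⟶ pullback p p :=
    pullback.lift (pullback.fst _ _ ≫ pullback.fst p h) (pullback.snd _ _ ≫ pullback.fst p h) (by
      rw [Category.assoc, Category.assoc, pullback.condition, pullback.condition_assoc])
  have hk₁ : inv k (inv (pullback.fst p p) u) = inv (pullback.fst _ _) (inv (pullback.fst p h) u) :=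
    congrArg (fun t => inv t u) (pullback.lift_fst _ _ _)
  have hk₂ : inv k (inv (pullback.snd p p) u) = inv (pullback.snd _ _) (inv (pullback.fst p h) u) :=
    congrArg (fun t => inv t u) (pullback.lift_snd _ _ _)
  have hk : pullback.diagonal (pullback.snd p h) ≫ k = pullback.fst p h ≫ pullback.diagonal p := by
    apply pullback.hom_ext
    · rw [Category.assoc, Category.assoc, pullback.lift_fst, pullback.diagonal_fst,
        pullback.diagonal_fst_assoc, Category.comp_id]
    · rw [Category.assoc, Category.assoc, pullback.lift_snd, pullback.diagonal_snd,
        pullback.diagonal_snd_assoc, Category.comp_id]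
  have hle : eqPred (pullback.snd p h) ≤ inv k (eqPred p) := by
    refine sInf_le ?_
    have := congrArg (fun t => inv t (eqPred p)) hk
    refine this.trans ?_
    change inv (pullback.fst p h) (inv (pullback.diagonal p) (eqPred p)) = ⊤
    rw [inv_diagonal_eqPred hp.2, map_top]
  rw [← hk₁, ← hk₂]
  refine (inf_le_inf_right _ hle).trans ?_
  rw [← map_inf]
  exact inv_mono k (eqPred_inf_le hp.2 u)

/-- By Beck-Chevalley for the kernel pair of `r`, `F ⊓ r^* r_!(F ⊓ y) ≤ y` says that `y` may be
substituted along `π₁^* F ⊓ π₂^* F`. Opens pulled back from `X` suffice, because those from `U` have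
equal inverse images under both projections. -/
theorem functional_iff (hp : IsLocalHomeo p) (F : (pullback p h : Locale.{u})) :
    inv (pullback.fst (pullback.snd p h) (pullback.snd p h)) F ⊓
        inv (pullback.snd (pullback.snd p h) (pullback.snd p h)) F ≤ eqPred (pullback.snd p h) ↔
      ∀ u, F ⊓ inv (pullback.snd p h)
        (directImage (pullback.snd p h) (F ⊓ inv (pullback.fst p h) u)) ≤
          inv (pullback.fst p h) u := by
  have hr := (hp.1.beckChevalley (IsPullback.of_hasPullback p h)).1
  obtain ⟨h₁, h₂⟩ := hr.beckChevalley
    (IsPullback.of_hasPullback (pullback.snd p h) (pullback.snd p h))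
  have hiff : ∀ y : (pullback p h : Locale.{u}),
      F ⊓ inv (pullback.snd p h) (directImage (pullback.snd p h) (F ⊓ y)) ≤ y ↔
      inv (pullback.fst (pullback.snd p h) (pullback.snd p h)) F ⊓
        inv (pullback.snd (pullback.snd p h) (pullback.snd p h)) F ⊓
          inv (pullback.fst (pullback.snd p h) (pullback.snd p h)) y ≤
            inv (pullback.snd (pullback.snd p h) (pullback.snd p h)) y := by
    intro y
    rw [inf_comm, ← h₂, h₁.gc.le_iff_le, map_inf, inf_right_comm]
  constructor
  · intro hF u
    rw [hiff]
    exact (inf_le_inf_right _ hF).trans (eqPred_snd_inf_le hp u)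
  · intro hF
    refine le_eqPred fun y => ?_
    refine isPullback_induction (IsPullback.of_hasPullback p h) (P := fun y =>
      inv (pullback.fst (pullback.snd p h) (pullback.snd p h)) F ⊓
        inv (pullback.snd (pullback.snd p h) (pullback.snd p h)) F ⊓
          inv (pullback.fst (pullback.snd p h) (pullback.snd p h)) y ≤
            inv (pullback.snd (pullback.snd p h) (pullback.snd p h)) y)
      (fun u b => ?_) (fun S hS => ?_) y
    · rw [map_inf, map_inf]
      refine le_inf ((inf_le_inf_left _ inf_le_left).trans ((hiff _).1 (hF u))) ?_
      refine inf_le_right.trans (inf_le_right.trans (le_of_eq ?_))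
      exact inv_fst_inv (p := pullback.snd p h) (h := pullback.snd p h) b
    · rw [map_sSup, inf_sSup_eq]
      refine iSup₂_le ?_
      rintro _ ⟨y, hy, rfl⟩
      exact (hS y hy).trans (inv_mono _ (le_sSup hy))

/-- The truth value of `f(n) ∈ u`, where `F` is the open `[f(n) = y]`. -/
noncomputable def valueOfGraph (F : (pullback p h : Locale.{u})) (u : X) : U :=
  directImage (pullback.snd p h) (F ⊓ inv (pullback.fst p h) u)

/-- The open `[f(n) = y]` recovered from the truth values of `f(n) ∈ u`. -/
noncomputable def graphOfValue (p : X ⟶ H) (h : U ⟶ H) (φ : X → U) : (pullback p h : Locale.{u}) :=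
  ⨆ u : {u // IsSection p u}, inv (pullback.fst p h) u.1 ⊓ inv (pullback.snd p h) (φ u.1)

theorem isEnumeration_valueOfGraph (hp : IsLocalHomeo p)
    (F : PartialSurjection (pullback.snd p h)) :
    IsEnumeration (inv p) (directImage p) (inv h) fun n => valueOfGraph (F.graph n) := by
  obtain ⟨hr, hbc⟩ := hp.1.beckChevalley (IsPullback.of_hasPullback p h)
  have hlin : ∀ n b c, valueOfGraph (F.graph n) (b ⊓ inv p c) =
      valueOfGraph (F.graph n) b ⊓ inv h c := by
    intro n b c
    unfold valueOfGraph
    rw [map_inf, inv_fst_inv, ← inf_assoc, inf_comm, hr.frobenius, inf_comm]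
  have hmono : ∀ n, Monotone (valueOfGraph (F.graph n)) := fun n b c hbc =>
    hr.gc.monotone_l (inf_le_inf_left _ (inv_mono _ hbc))
  refine ⟨fun n S => ?_, fun n b c => ?_, hlin, fun b => ?_⟩
  · unfold valueOfGraph
    rw [map_sSup, inf_sSup_eq, hr.gc.l_iSup₂, iSup_image, sSup_image]
  · refine le_antisymm (le_inf (hmono n inf_le_left) (hmono n inf_le_right)) ?_
    unfold valueOfGraph
    -- Frobenius puts both values under one `r_!`; functionality then recovers `s^* b` from `F ⊓ r^*
    -- r_!(F ⊓ s^* b)`.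
    rw [← hr.frobenius]
    refine hr.gc.monotone_l (le_inf (inf_le_right.trans inf_le_left) ?_)
    rw [map_inf]
    refine le_inf ?_ (inf_le_right.trans inf_le_right)
    refine le_trans ?_ ((functional_iff hp _).1 (F.functional n) b)
    exact le_inf (inf_le_right.trans inf_le_left) inf_le_left
  · unfold valueOfGraph
    rw [← hr.gc.l_iSup, ← iSup_inf_eq, F.surjective, top_inf_eq]
    have := hbc b ⊤
    rwa [map_top, inf_top_eq, inf_top_eq] at this

/-- One inequality uses that sections cover `X`, together with the unit of `r_! ⊣ r^*`. The other is
checked on rectangles, where Beck-Chevalley reduces it to the defining inequality of a section. -/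
theorem graphOfValue_valueOfGraph (hp : IsLocalHomeo p) (F : (pullback p h : Locale.{u})) :
    graphOfValue p h (valueOfGraph F) = F := by
  obtain ⟨hr, hbc⟩ := hp.1.beckChevalley (IsPullback.of_hasPullback p h)
  apply le_antisymm
  · refine iSup_le fun u => ?_
    unfold valueOfGraph
    refine isPullback_induction (IsPullback.of_hasPullback p h) (P := fun y =>
      inv (pullback.fst p h) u.1 ⊓ inv (pullback.snd p h)
        (directImage (pullback.snd p h) (y ⊓ inv (pullback.fst p h) u.1)) ≤ y)
      (fun v b => ?_) (fun S hS => ?_) F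
    · rw [inf_right_comm, ← map_inf, hbc, map_inf, ← inv_fst_inv, ← inf_assoc, ← map_inf,
        inf_comm v]
      exact inf_le_inf_right _ (inv_mono _ (u.2 v))
    · rw [sSup_inf_eq, hr.gc.l_iSup₂, map_iSup₂, inf_iSup₂_eq]
      exact iSup₂_le fun y hy => (hS y hy).trans (le_sSup hy)
  · calc F = ⨆ u : {u // IsSection p u}, F ⊓ inv (pullback.fst p h) u.1 := by
          rw [← inf_iSup_eq, ← map_iSup, iSup_isSection hp, map_top, inf_top_eq]
      _ ≤ _ := iSup_mono fun u => le_inf inf_le_right (hr.le_inv_directImage _)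

variable {φ : ℕ → X → U}

theorem IsEnumeration.eq_inf_inv_directImage (hp : IsLocalHomeo p)
    (H : IsEnumeration (inv p) (directImage p) (inv h) φ) (n : ℕ) (u : X) :
    φ n u = φ n u ⊓ inv h (directImage p u) := by
  rw [← H.linear, inf_eq_left.2 (hp.1.le_inv_directImage u)]

theorem IsEnumeration.valueOfGraph_graphOfValue (hp : IsLocalHomeo p)
    (H : IsEnumeration (inv p) (directImage p) (inv h) φ) (n : ℕ) :
    valueOfGraph (graphOfValue p h (φ n)) = φ n := by
  obtain ⟨hr, hbc⟩ := hp.1.beckChevalley (IsPullback.of_hasPullback p h)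
  funext w
  unfold valueOfGraph graphOfValue
  -- For a section, `u ⊓ p^* p_!(u ⊓ w) = u ⊓ w`, so Beck-Chevalley and linearity collapse each
  -- term; the join over the cover then yields `φ n ⊤ ⊓ φ n w`.
  have hw : ∀ u : {u // IsSection p u},
      directImage (pullback.snd p h) (inv (pullback.fst p h) u.1 ⊓
        inv (pullback.snd p h) (φ n u.1) ⊓ inv (pullback.fst p h) w) = φ n (u.1 ⊓ w) := by
    intro u
    rw [inf_right_comm, ← map_inf, hbc, inf_comm, ← H.linear]
    congr 1
    exact le_antisymm (le_inf inf_le_left (u.2 w))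
      (le_inf inf_le_left (hp.1.le_inv_directImage _))
  rw [iSup_inf_eq, hr.gc.l_iSup]
  simp only [hw, H.value_inf]
  have htop := H.value_sSup n (Set.range fun u : {u // IsSection p u} => u.1)
  rw [← Set.range_comp, sSup_range, sSup_range, iSup_isSection hp] at htop
  rw [← iSup_inf_eq]
  change (⨆ u, (φ n ∘ fun u : {u // IsSection p u} => u.1) u) ⊓ _ = _
  rw [← htop, ← H.value_inf, top_inf_eq]

/-- The partial surjection with given truth values. -/
noncomputable def IsEnumeration.partialSurjection (hp : IsLocalHomeo p)
    (H : IsEnumeration (inv p) (directImage p) (inv h) φ) :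
    PartialSurjection (pullback.snd p h) where
  graph n := graphOfValue p h (φ n)
  functional n := by
    rw [functional_iff hp]
    intro w
    change _ ⊓ inv _ (valueOfGraph _ w) ≤ _
    rw [H.valueOfGraph_graphOfValue hp, graphOfValue, iSup_inf_eq]
    refine iSup_le fun u => ?_
    -- The value at `u ⊓ w` lies below `h^* p_!(u ⊓ w)`; moved to `X`, this reduces the claim to `u`
    -- being a section.
    rw [inf_assoc, ← map_inf, ← H.value_inf, H.eq_inf_inv_directImage hp, map_inf, ← inv_fst_inv, inf_left_comm,
      ← map_inf]
    exact inf_le_right.trans (inv_mono _ (u.2 w))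
  surjective := by
    unfold graphOfValue
    rw [iSup_comm]
    have hu : ∀ u : {u // IsSection p u}, (⨆ n, inv (pullback.fst p h) u.1 ⊓
        inv (pullback.snd p h) (φ n u.1)) = inv (pullback.fst p h) u.1 := by
      intro u
      rw [← inf_iSup_eq, ← map_iSup, H.surjective, ← inv_fst_inv, ← map_inf,
        inf_eq_left.2 (hp.1.le_inv_directImage _)]
    simp only [hu]
    rw [← map_iSup, iSup_isSection hp, map_top]

end Graph

/-! ### The locale of partial surjections -/

section Classifier

variable {X H : Locale.{u}} (p : X ⟶ H)

/-- The locale of partial surjections from `ℕ` onto the fibres of `p`. -/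
def enumerationLocale : Locale.{u} := Locale.of (enumerationFrame (inv p) (directImage p))

/-- The projection of the locale of partial surjections to the base. -/
def enumerationBase : enumerationLocale p ⟶ H :=
  ofInv (X := enumerationLocale p) (baseHom (inv p) (directImage p))

variable {p}

theorem enumerationBase_isOpenSurjection (hp : IsOpenMap p) :
    IsOpenSurjection (enumerationBase p) := by
  refine ⟨baseHom_exists_adjoint hp.gc hp.frobenius, ⟨fun {Z} g k hgk => hom_ext fun z => ?_⟩⟩
  refine baseHom_injective hp.gc hp.frobenius ?_
  exact congrArg (fun t => inv t z) hgk

variable {U : Locale.{u}}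

theorem isEnumeration_point (hp : IsOpenMap p) (t : U ⟶ enumerationLocale p) :
    IsEnumeration (inv p) (directImage p) (inv (t ≫ enumerationBase p))
      fun n b => inv t (valueOpen (inv p) (directImage p) n b) :=
  (valueOpen_isEnumeration hp.le_inv_directImage).comp (inv t)

/-- The partial surjection onto a fibre given by a point of the locale of partial surjections. -/
noncomputable def fibrePartialSurjectionOfPoint (hp : IsLocalHomeo p)
    (t : U ⟶ enumerationLocale p) : FibrePartialSurjection p U where
  point := t ≫ enumerationBase p
  partialSurjection := (isEnumeration_point hp.1 t).partialSurjection hp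

theorem fibrePartialSurjectionOfPoint_injective (hp : IsLocalHomeo p) :
    Function.Injective (fibrePartialSurjectionOfPoint (U := U) hp) := by
  intro t t' htt
  have hpt : t ≫ enumerationBase p = t' ≫ enumerationBase p :=
    congrArg FibrePartialSurjection.point htt
  have hval : ∀ t : U ⟶ enumerationLocale p, ∀ n,
      valueOfGraph ((fibrePartialSurjectionOfPoint hp t).partialSurjection.graph n) =
        fun b => inv t (valueOpen (inv p) (directImage p) n b) := fun t n =>
    (isEnumeration_point hp.1 t).valueOfGraph_graphOfValue hp n
  refine congrArg ofInv (enumerationFrame_hom_ext (t := inv t) (t' := inv t') (fun a => ?_)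
    fun n b => ?_)
  · exact congrArg (fun t => inv t a) hpt
  · have h := hval t n
    rw [htt, hval t' n] at h
    exact congrFun h.symm b

/-- Graphs over propositionally equal points have different types; comparing the truth values, which
live in `U`, avoids transport. -/
theorem FibrePartialSurjection.ext_graphOfValue {a b : FibrePartialSurjection p U}
    (w : a.point = b.point) (φ : ℕ → X → U)
    (ha : ∀ n, a.partialSurjection.graph n = graphOfValue p a.point (φ n))
    (hb : ∀ n, b.partialSurjection.graph n = graphOfValue p b.point (φ n)) : a = b := by
  obtain ⟨h, F, _, _⟩ := a
  obtain ⟨h', F', _, _⟩ := b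
  obtain rfl : h = h' := w
  obtain rfl : F = F' := funext fun n => (ha n).trans (hb n).symm
  rfl

theorem fibrePartialSurjectionOfPoint_surjective (hp : IsLocalHomeo p) :
    Function.Surjective (fibrePartialSurjectionOfPoint (U := U) hp) := by
  intro a
  have E := isEnumeration_valueOfGraph hp a.partialSurjection
  let t : U ⟶ enumerationLocale p := ofInv (Y := enumerationLocale p) E.desc
  refine ⟨t, FibrePartialSurjection.ext_graphOfValue (hom_ext fun z => E.desc_baseHom z)
    (fun n => valueOfGraph (a.partialSurjection.graph n)) (fun n => ?_) fun n => ?_⟩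
  · have hval : (fun b => inv t (valueOpen (inv p) (directImage p) n b)) =
        valueOfGraph (a.partialSurjection.graph n) := funext fun b => E.desc_valueOpen n b
    rw [← hval]
    rfl
  · exact (graphOfValue_valueOfGraph hp _).symm

/-- Inverse images preserve joins and binary meets, and the join is indexed by sections of `p`
itself, hence by a set independent of the point `h`. -/
theorem fibreMap_graphOfValue {V : Locale.{u}} (g : V ⟶ U) {h : U ⟶ H} {h' : V ⟶ H}
    (w : h' = g ≫ h) (φ : X → U) :
    inv (fibreMap p g w) (graphOfValue p h φ) = graphOfValue p h' fun u => inv g (φ u) := by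
  unfold graphOfValue
  rw [map_iSup]
  refine iSup_congr fun u => ?_
  rw [map_inf]
  congr 1
  · exact congrArg (fun t => inv t u.1) (pullback.lift_fst _ _ _)
  · exact congrArg (fun t => inv t (φ u.1)) (pullback.lift_snd _ _ _)

end Classifier

end Locale

theorem mainTheorem11 {X H : Locale.{u}} (p : X ⟶ H) (hp : Locale.IsLocalHomeo p) :
    ∃ (P : Locale.{u}) (q : P ⟶ H), Locale.IsOpenSurjection q ∧
      ∃ e : ∀ U : Locale.{u}, (U ⟶ P) ≃ Locale.FibrePartialSurjection p U,
        (∀ (U : Locale.{u}) (t : U ⟶ P), (e U t).point = t ≫ q) ∧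
        (∀ (U V : Locale.{u}) (g : V ⟶ U) (t : U ⟶ P),
          Locale.FibrePartialSurjection.IsRestriction g (e U t) (e V (g ≫ t))) := by
  refine ⟨Locale.enumerationLocale p, Locale.enumerationBase p,
    Locale.enumerationBase_isOpenSurjection hp.1,
    fun U => Equiv.ofBijective (Locale.fibrePartialSurjectionOfPoint hp)
      ⟨Locale.fibrePartialSurjectionOfPoint_injective hp,
        Locale.fibrePartialSurjectionOfPoint_surjective hp⟩, fun U t => rfl, fun U V g t => ?_⟩
  exact ⟨Category.assoc g t _, fun n => (Locale.fibreMap_graphOfValue g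
    (h := t ≫ Locale.enumerationBase p) (Category.assoc g t _)
    fun b => Locale.inv t (Locale.valueOpen (Locale.inv p) (Locale.directImage p) n b)).symm⟩
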